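/- Let $G$ be a connected graph on the nodes $\{1,\dots,N\}$, let $\mathcal N_i$ be the set of neighbours of $i$, and let $V_i\sim P_i$ be the data sample of node $i$. Let $l_i(x,v)$ ($x\in\mathbb R^d$) be the loss of node $i$, with $l_i(x,V_i)$ integrable for every $x$, and let $f_i(x)=\mathbb E[l_i(x,V_i)]$. For $\beta=[\beta_1,\dots,\beta_N]\in(\mathbb R^d)^N$ with the Euclidean norm consider $$\min_\beta\ \frac1N\sum_{i=1}^N f_i(\beta_i)\quad\text{s.t.}\quad \beta\in\mathcal B=\mathcal B_1\cap\dots\cap\mathcal B_N,\qquad \mathcal B_n=\{\beta:\ \beta_n=\beta_k\ \ \forall k\in\mathcal N_n\}.$$ Assume: * every $f_i$ is convex, and the set $\mathcal B^*$ of optimal solutions is nonempty; * $g_i(x,v)$ is a jointly measurable subgradient oracle: either, for every $x$, $g_i(x,v)$ is a subgradient of $l_i(\cdot,v)$ at $x$ for $P_i$-almost every $v$, or, more generally, $\mathbb E[g_i(x,V_i)]$ is a subgradient of $f_i$ at $x$ for every $x$; * there is a constant $\sigma$ with $\mathbb E\|g_i(x,V_i)\|^2\le\sigma(1+\|x\|^2)$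 for all $i$ and $x$; * the stepsizes are deterministic with $\alpha_k\ge 0$, $\sum_k\alpha_k=\infty$ and $\sum_k\alpha_k^2<\infty$. From an arbitrary deterministic $\beta^0$, iterate for $k=0,1,2,\dots$ as follows, independently over the iterations. Select a node $m$ uniformly at random and, independently, $r$ uniform on $[0,1]$. If $r\le 1/2$, draw a sample $v\sim P_m$ and set $\beta_m^{k+1}=\beta_m^k-\alpha_k\frac1N g_m(\beta_m^k,v)$, leaving the other components unchanged. If $r>1/2$, set $\beta_j^{k+1}=\frac1{1+|\mathcal N_m|}\sum_{n\in\{m\}\cup\mathcal N_m}\beta_n^k$ for all $j\in\{m\}\cup\mathcal N_m$, leaving the other components unchanged. Then, almost surely, the distance $DF(\beta^k)$ of $\beta^k$ to the feasible (consensus) region $\mathcal B$ and the distance $DO(\beta^k)$ of $\beta^k$ to the optimal set $\mathcal B^*$ both converge to $0$ as $k\to\infty$. -/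

import Mathlib

open MeasureTheory ProbabilityTheory Filter Topology
open scoped ENNReal

noncomputable section

namespace AsyncSGD

/-- The space of one local optimization variable, with the Euclidean norm. -/
abbrev LocalVar (d : ℕ) : Type := EuclideanSpace ℝ (Fin d)

/-- The stacked variable `β = [β₁, …, β_N]`, with the Euclidean (Frobenius) norm. -/
abbrev NetVar (N d : ℕ) : Type := PiLp 2 (fun _ : Fin N => LocalVar d)

/-- `s` is a subgradient of the real-valued function `f` at `x`. -/
def HasSubgradientAt {d : ℕ} (f : LocalVar d → ℝ) (s x : LocalVar d) : Prop :=
  ∀ y, f x + inner ℝ s (y - x) ≤ f y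

variable {N d : ℕ} {S : Type*} [MeasurableSpace S]

/-- The expected loss `f(x) = 𝔼[l(x, V)]` of one node, where `V` has law `P`. -/
def expectedLoss (P : Measure S) (l : LocalVar d → S → ℝ) (x : LocalVar d) : ℝ :=
  ∫ v, l x v ∂P

/-- `g` is a subgradient oracle for the loss `l` under the data law `P`: either `g x v` is a
subgradient of the sampled loss `l(·, v)` at `x` for almost every sample `v`, or, more generally,
`g` is unbiased, that is, its mean at `x` is a subgradient of the expected loss at `x`. -/
def IsSubgradientOracle (P : Measure S) (l : LocalVar d → S → ℝ)
    (g : LocalVar d → S → LocalVar d) : Prop :=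
  (∀ x, ∀ᵐ v ∂P, HasSubgradientAt (fun y => l y v) (g x v) x) ∨
    (∀ x, HasSubgradientAt (expectedLoss P l) (∫ v, g x v ∂P) x)

/-- The objective `(1/N) ∑ᵢ fᵢ(βᵢ)`. -/
def objective (P : Fin N → Measure S) (l : Fin N → LocalVar d → S → ℝ) (β : NetVar N d) : ℝ :=
  (1 / (N : ℝ)) * ∑ i, expectedLoss (P i) (l i) (β i)

/-- The constraint set of node `n`: its variable agrees with those of all its neighbours. -/
def localConsensus (d : ℕ) (G : SimpleGraph (Fin N)) (n : Fin N) : Set (NetVar N d) :=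
  {β | ∀ k, G.Adj n k → β n = β k}

/-- The feasible region, the intersection of all the local constraint sets. -/
def feasibleSet (d : ℕ) (G : SimpleGraph (Fin N)) : Set (NetVar N d) :=
  ⋂ n, localConsensus d G n

/-- The set of minimizers of the objective over the feasible region. -/
def optimalSet (G : SimpleGraph (Fin N)) (P : Fin N → Measure S)
    (l : Fin N → LocalVar d → S → ℝ) : Set (NetVar N d) :=
  {β | β ∈ feasibleSet d G ∧ ∀ γ ∈ feasibleSet d G, objective P l β ≤ objective P l γ}

/-- Distance to the feasible region. -/
def DF (G : SimpleGraph (Fin N)) (β : NetVar N d) : ℝ :=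
  Metric.infDist β (feasibleSet d G)

/-- Distance to the optimal region. -/
def DO (G : SimpleGraph (Fin N)) (P : Fin N → Measure S) (l : Fin N → LocalVar d → S → ℝ)
    (β : NetVar N d) : ℝ :=
  Metric.infDist β (optimalSet G P l)

/-- Local stochastic subgradient step at node `m` with stepsize `a` and data sample `v`:
`β_m` becomes `β_m - a (1/N) g_m(β_m, v)`; the other nodes keep their variables. -/
def gradientStep (g : Fin N → LocalVar d → S → LocalVar d) (a : ℝ) (m : Fin N) (v : S)
    (β : NetVar N d) : NetVar N d :=
  WithLp.toLp 2 fun j => if j = m then β m - (a * (1 / (N : ℝ))) • g m (β m) v else β j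

/-- Neighbourhood averaging at node `m`: node `m` and all its neighbours receive the average of
their variables; the other nodes keep their variables. -/
def averagingStep (G : SimpleGraph (Fin N)) [DecidableRel G.Adj] (m : Fin N)
    (β : NetVar N d) : NetVar N d :=
  WithLp.toLp 2 fun j =>
    if j ∈ insert m (G.neighborFinset m) then
      (1 / (1 + (G.degree m : ℝ))) • ∑ k ∈ insert m (G.neighborFinset m), β k
    else β j

/-- One iteration, driven by `(m, r, v)`: the selected node `m`, the number `r ∈ [0, 1]` that
decides between the two kinds of updates, and a data sample `v` of node `m` (which is ignored
in an averaging iteration). -/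
def step (G : SimpleGraph (Fin N)) [DecidableRel G.Adj]
    (g : Fin N → LocalVar d → S → LocalVar d) (a : ℝ) (draw : Fin N × ℝ × S)
    (β : NetVar N d) : NetVar N d :=
  if draw.2.1 ≤ 1 / 2 then gradientStep g a draw.1 draw.2.2 β else averagingStep G draw.1 β

/-- The iterates of the algorithm along the sequence `draws`. -/
def iterates (G : SimpleGraph (Fin N)) [DecidableRel G.Adj]
    (g : Fin N → LocalVar d → S → LocalVar d) (α : ℕ → ℝ) (β₀ : NetVar N d)
    (draws : ℕ → Fin N × ℝ × S) : ℕ → NetVar N d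
  | 0 => β₀
  | k + 1 => step G g (α k) (draws k) (iterates G g α β₀ draws k)

/-- The law of the randomness `(m, r, v)` of one iteration: `m` is uniform on the nodes, `r` is
uniform on `[0, 1]` and independent of `(m, v)`, and given `m = i` the sample `v` has law `P i`. -/
def drawLaw (P : Fin N → Measure S) : Measure (Fin N × ℝ × S) :=
  ∑ i, (N : ℝ≥0∞)⁻¹ •
    (Measure.dirac i).prod ((volume.restrict (Set.Icc (0 : ℝ) 1)).prod (P i))

end AsyncSGD

end

/-! Fix an optimal point `b`, a consensus point, and follow `V = ‖β - b‖²`. An averaging step is an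
orthogonal projection onto a subspace containing `b`, so it lowers `V` by exactly the squared
displacement. By connectedness, the sum of these displacements over the nodes controls the squared
consensus error (`exists_linear_regularity`). A gradient step has mean first-order effect `-2(α_k/N)
⟨s, β_m - b_m⟩`, with `s` the mean of the oracle.

Since `β` is infeasible, the objective at `β` may lie below the optimum. It is therefore evaluated
at the feasible point `γ` that copies one fixed node `n₀` to all nodes. Exchanging `β` for `γ` costs
a term linear in `‖β - γ‖`, which Young's inequality splits into a part absorbed by the consensus
descent and a part of order `α_k²`. This gives the drift inequality `exists_drift`: given the past,
`V` grows on average by at most a factor `1 + O(α_k²)` plus `O(α_k²)`, less the consensus error and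
`α_k/N` times the optimality gap of `γ`.

By Robbins–Siegmund, almost surely `‖β^k - b‖` converges and the subtracted terms are summable. This
holds simultaneously for a countable dense set of optimal `b`. Summability gives consensus, and
together with `∑ α_k = ∞` a subsequence with vanishing gap. A limit point `y` of it is optimal, and
dense points `b` near `y` force the whole sequence towards the optimal set (`tendsto_DF_DO`). -/

/-! ### Almost supermartingales driven by independent draws -/

/-- Disintegration of a set integral along an independent variable. -/
lemma setLIntegral_comp_of_indep {Ω X Z : Type*} {m mΩ : MeasurableSpace Ω} [MeasurableSpace X]
    [MeasurableSpace Z] {μ : Measure Ω} [IsProbabilityMeasure μ] (hm : m ≤ mΩ)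
    {ξ : Ω → Z} (hξ : Measurable ξ) {x : Ω → X} (hx : Measurable[m] x)
    (hind : Indep m (MeasurableSpace.comap ξ inferInstance) μ)
    {s : Set Ω} (hs : MeasurableSet[m] s) {W : Z → X → ℝ≥0∞}
    (hW : Measurable (Function.uncurry W)) :
    ∫⁻ ω in s, W (ξ ω) (x ω) ∂μ = ∫⁻ ω in s, ∫⁻ z, W z (x ω) ∂(μ.map ξ) ∂μ := by
  classical
  -- The indicator of `s` travels with `x`: the pair is `m`-measurable, hence independent of `ξ`,
  -- and Tonelli applies to the product law.
  set h : Ω → ℝ≥0∞ × X := fun ω => (s.indicator (fun _ => 1) ω, x ω) with hh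
  have hhm : Measurable[m] h := Measurable.prodMk (measurable_const.indicator hs) hx
  have hhm' : Measurable h := hhm.mono hm le_rfl
  have hi : IndepFun h ξ μ := by
    rw [IndepFun_iff_Indep]
    exact indep_of_indep_of_le_left hind (measurable_iff_comap_le.mp hhm)
  have hlaw := (indepFun_iff_map_prod_eq_prod_map_map hhm'.aemeasurable hξ.aemeasurable).1 hi
  have := Measure.isProbabilityMeasure_map (μ := μ) hξ.aemeasurable
  have := Measure.isProbabilityMeasure_map (μ := μ) hhm'.aemeasurable
  have hW1 : Measurable (fun p : (ℝ≥0∞ × X) × Z => p.1.1 * W p.2 p.1.2) := by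
    have : Measurable (fun p : (ℝ≥0∞ × X) × Z => Function.uncurry W (p.2, p.1.2)) :=
      hW.comp (by fun_prop)
    exact (by fun_prop : Measurable fun p : (ℝ≥0∞ × X) × Z => p.1.1).mul this
  have hW2 : ∀ y, Measurable fun z => W z y := fun y =>
    hW.comp (by fun_prop : Measurable fun z : Z => (z, y))
  have hs' := hm _ hs
  calc ∫⁻ ω in s, W (ξ ω) (x ω) ∂μ = ∫⁻ ω, (h ω).1 * W (ξ ω) (h ω).2 ∂μ := by
        rw [← lintegral_indicator hs']
        refine lintegral_congr fun ω => ?_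
        by_cases hω : ω ∈ s <;> simp [hh, hω]
    _ = ∫⁻ p, p.1.1 * W p.2 p.1.2 ∂(μ.map fun ω => (h ω, ξ ω)) := by
        rw [lintegral_map hW1 (hhm'.prodMk hξ)]
    _ = ∫⁻ y, y.1 * ∫⁻ z, W z y.2 ∂(μ.map ξ) ∂(μ.map h) := by
        rw [hlaw, lintegral_prod _ hW1.aemeasurable]
        refine lintegral_congr fun y => ?_
        exact lintegral_const_mul y.1 (hW2 y.2)
    _ = ∫⁻ ω, (h ω).1 * ∫⁻ z, W z (h ω).2 ∂(μ.map ξ) ∂μ := by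
        rw [lintegral_map _ hhm']
        refine measurable_fst.mul ?_
        have : Measurable (fun p : X × Z => W p.2 p.1) := hW.comp measurable_swap
        exact this.lintegral_prod_right'.comp measurable_snd
    _ = _ := by
        rw [← lintegral_indicator hs']
        refine lintegral_congr fun ω => ?_
        by_cases hω : ω ∈ s <;> simp [hh, hω]

/-- The Robbins–Siegmund theorem with deterministic perturbations. -/
theorem robbinsSiegmund {Ω : Type*} {mΩ : MeasurableSpace Ω} {μ : Measure Ω}
    [IsProbabilityMeasure μ] (ℱ : Filtration ℕ mΩ) {V U : ℕ → Ω → ℝ} {a b : ℕ → ℝ}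
    (hVm : ∀ k, StronglyMeasurable[ℱ k] (V k))
    (hV : ∀ k ω, 0 ≤ V k ω) (hU : ∀ k ω, 0 ≤ U k ω)
    (hVi : ∀ k, Integrable (V k) μ) (hUi : ∀ k, Integrable (U k) μ)
    (ha : ∀ k, 0 ≤ a k) (hb : ∀ k, 0 ≤ b k) (has : Summable a) (hbs : Summable b)
    (h : ∀ k s, MeasurableSet[ℱ k] s → ∫ ω in s, V (k + 1) ω ∂μ + ∫ ω in s, U k ω ∂μ ≤
      ∫ ω in s, ((1 + a k) * V k ω + b k) ∂μ) :
    ∀ᵐ ω ∂μ, (∃ L, Tendsto (fun k => V k ω) atTop (𝓝 L)) ∧ Summable fun k => U k ω := by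
  -- Dividing by `p k` removes the growth factors `1 + a k`. The product stays bounded because `a`
  -- is summable, so nothing is lost on returning to `V` and `U`.
  set p : ℕ → ℝ := fun k => ∏ j ∈ Finset.range k, (1 + a j) with hp
  have hps : ∀ k, p (k + 1) = p k * (1 + a k) := fun k => Finset.prod_range_succ _ _
  have hp1 : ∀ k, 1 ≤ p k := by
    intro k
    induction k with
    | zero => simp [hp]
    | succ k ih => rw [hps]; nlinarith [ha k, mul_nonneg (zero_le_one.trans ih) (ha k)]
  have hp0 : ∀ k, 0 < p k := fun k => one_pos.trans_le (hp1 k)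
  have hpmono : Monotone p := monotone_nat_of_le_succ fun k => by
    rw [hps]; nlinarith [mul_nonneg (hp0 k).le (ha k)]
  have hpB : ∀ k, p k ≤ Real.exp (∑' j, a j) := by
    intro k
    calc p k ≤ ∏ j ∈ Finset.range k, Real.exp (a j) :=
          Finset.prod_le_prod (fun j _ => by linarith [ha j])
            (fun j _ => by linarith [Real.add_one_le_exp (a j)])
      _ = Real.exp (∑ j ∈ Finset.range k, a j) := (Real.exp_sum _ _).symm
      _ ≤ _ := Real.exp_le_exp.2 (has.sum_le_tsum _ fun j _ => ha j)
  have hpbdd : BddAbove (Set.range p) := ⟨_, by rintro _ ⟨k, rfl⟩; exact hpB k⟩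
  obtain ⟨pL, hpL⟩ : ∃ L, Tendsto p atTop (𝓝 L) := ⟨_, tendsto_atTop_ciSup hpmono hpbdd⟩
  set c : ℕ → ℝ := fun k => b k / p (k + 1) with hc
  have hc0 : ∀ k, 0 ≤ c k := fun k => div_nonneg (hb k) (hp0 _).le
  have hcs : Summable c := Summable.of_nonneg_of_le hc0
    (fun k => div_le_self (hb k) (hp1 _)) hbs
  -- Adding the tail of the rescaled perturbations turns the drift inequality into a genuine
  -- supermartingale inequality, since `t k - t (k + 1) = c k`.
  set t : ℕ → ℝ := fun k => ∑' j, c (j + k) with ht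
  have htl : Tendsto t atTop (𝓝 0) := tendsto_sum_nat_add c
  have ht0 : ∀ k, 0 ≤ t k := fun k => tsum_nonneg fun j => hc0 _
  have hts : ∀ k, t k = c k + t (k + 1) := by
    intro k
    have := ((summable_nat_add_iff k).2 hcs).tsum_eq_zero_add
    simp only [ht]
    rw [this]
    simp only [zero_add]
    congr 2
    ext j; congr 1; ring
  set Y : ℕ → Ω → ℝ := fun k ω => V k ω / p k + t k with hY
  have hYi : ∀ k, Integrable (Y k) μ := fun k =>
    ((hVi k).div_const _).add (integrable_const _)
  have hY0 : ∀ k ω, 0 ≤ Y k ω := fun k ω =>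
    add_nonneg (div_nonneg (hV k ω) (hp0 k).le) (ht0 k)
  have hstep : ∀ k s, MeasurableSet[ℱ k] s →
      ∫ ω in s, Y (k + 1) ω ∂μ + (∫ ω in s, U k ω ∂μ) / p (k + 1) ≤ ∫ ω in s, Y k ω ∂μ := by
    intro k s hs
    have h1 := h k s hs
    have e1 : ∀ k, ∫ ω in s, Y k ω ∂μ = (∫ ω in s, V k ω ∂μ) / p k + μ.real s * t k := by
      intro k
      simp only [hY]
      rw [integral_add ((hVi k).integrableOn.div_const _) (integrable_const _), integral_div]
      simp
    rw [integral_add ((hVi k).integrableOn.const_mul _) (integrable_const _),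
      integral_const_mul] at h1
    simp only [integral_const, smul_eq_mul, measureReal_restrict_apply_univ] at h1
    rw [e1, e1, hts k]
    have hpk := hp0 k
    have hpk' := hp0 (k + 1)
    have hak : 0 < 1 + a k := by linarith [ha k]
    have h2 : ((∫ ω in s, V (k + 1) ω ∂μ) + ∫ ω in s, U k ω ∂μ) / p (k + 1) ≤
        ((1 + a k) * (∫ ω in s, V k ω ∂μ) + μ.real s * b k) / p (k + 1) := by gcongr
    have h3 : ((1 + a k) * (∫ ω in s, V k ω ∂μ) + μ.real s * b k) / p (k + 1)
        = (∫ ω in s, V k ω ∂μ) / p k + μ.real s * c k := by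
      simp only [hc, hps]; field_simp
    rw [h3, add_div] at h2
    linarith
  have hUs0 : ∀ k (s : Set Ω), 0 ≤ (∫ ω in s, U k ω ∂μ) / p (k + 1) := fun k s =>
    div_nonneg (integral_nonneg (hU k)) (hp0 _).le
  have hsuper : Supermartingale Y ℱ μ :=
    supermartingale_of_setIntegral_succ_le
      (fun k => ((hVm k).measurable.div_const _).stronglyMeasurable.add stronglyMeasurable_const) hYi
      fun k s hs => by linarith [hstep k s hs, hUs0 k s]
  have hYdec : ∀ k, ∫ ω, Y (k + 1) ω ∂μ + (∫ ω, U k ω ∂μ) / p (k + 1) ≤ ∫ ω, Y k ω ∂μ := by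
    intro k; simpa using hstep k Set.univ MeasurableSet.univ
  have hYle : ∀ k, ∫ ω, Y k ω ∂μ ≤ ∫ ω, Y 0 ω ∂μ := by
    intro k
    induction k with
    | zero => rfl
    | succ k ih => linarith [hYdec k, show 0 ≤ (∫ ω, U k ω ∂μ) / p (k + 1) by simpa using hUs0 k Set.univ]
  -- Since `Y ≥ 0`, its `L¹` norms are its expectations, bounded by the initial one; submartingale
  -- convergence applies to `-Y`.
  have hconv : ∀ᵐ ω ∂μ, ∃ L, Tendsto (fun k => (-Y) k ω) atTop (𝓝 L) := by
    refine hsuper.neg.exists_ae_tendsto_of_bdd (R := (∫ ω, Y 0 ω ∂μ).toNNReal) fun k => ?_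
    rw [eLpNorm_one_eq_lintegral_enorm]
    have : ∫⁻ ω, ‖(-Y) k ω‖ₑ ∂μ = ENNReal.ofReal (∫ ω, Y k ω ∂μ) := by
      rw [ofReal_integral_eq_lintegral_ofReal (hYi k) (ae_of_all _ (hY0 k))]
      refine lintegral_congr fun ω => ?_
      rw [Pi.neg_apply, Pi.neg_apply, enorm_neg, Real.enorm_of_nonneg (hY0 k ω)]
    rw [this]
    exact ENNReal.ofReal_le_ofReal (hYle k)
  have hsumU : ∀ᵐ ω ∂μ, Summable fun k => U k ω := by
    -- The expected decrements of `Y` telescope; the weights `1 / p (k + 1)` are bounded below and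
    -- can be dropped afterwards.
    have hpart : ∀ n, ∑ k ∈ Finset.range n, (∫ ω, U k ω ∂μ) / p (k + 1) ≤
        ∫ ω, Y 0 ω ∂μ - ∫ ω, Y n ω ∂μ := by
      intro n
      induction n with
      | zero => simp
      | succ n ih => rw [Finset.sum_range_succ]; linarith [hYdec n]
    have hEU0 : ∀ k, 0 ≤ ∫ ω, U k ω ∂μ := fun k => integral_nonneg (hU k)
    have hEs : Summable fun k => (∫ ω, U k ω ∂μ) / p (k + 1) :=
      summable_of_sum_range_le (fun k => div_nonneg (hEU0 k) (hp0 _).le)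
        fun n => (hpart n).trans (sub_le_self _ (integral_nonneg (hY0 n)))
    have hEs' : Summable fun k => ∫ ω, U k ω ∂μ := by
      refine Summable.of_nonneg_of_le hEU0 (fun k => ?_) (hEs.mul_right (Real.exp (∑' j, a j)))
      calc ∫ ω, U k ω ∂μ = (∫ ω, U k ω ∂μ) / p (k + 1) * p (k + 1) := by
            field_simp [(hp0 (k + 1)).ne']
        _ ≤ _ := mul_le_mul_of_nonneg_left (hpB _) (div_nonneg (hEU0 k) (hp0 _).le)
    have hfin : ∫⁻ ω, ∑' k, ENNReal.ofReal (U k ω) ∂μ ≠ ∞ := by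
      rw [lintegral_tsum fun k => (hUi k).1.aemeasurable.ennreal_ofReal]
      simp_rw [fun k => (ofReal_integral_eq_lintegral_ofReal (hUi k) (ae_of_all _ (hU k))).symm]
      exact hEs'.tsum_ofReal_ne_top
    have hae := ae_lt_top' (AEMeasurable.tsum
      fun k => (hUi k).1.aemeasurable.ennreal_ofReal) hfin
    filter_upwards [hae] with ω hω
    have := ENNReal.summable_toReal hω.ne
    simpa [ENNReal.toReal_ofReal (hU _ ω)] using this
  filter_upwards [hconv, hsumU] with ω hω hω'
  refine ⟨?_, hω'⟩
  obtain ⟨L, hL⟩ := hω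
  refine ⟨pL * (-L - 0), ?_⟩
  refine (hpL.mul (hL.neg.sub htl)).congr fun k => ?_
  simp only [Pi.neg_apply, hY, neg_neg, add_sub_cancel_right]
  field_simp [(hp0 k).ne']

/-- The σ-algebras generated by the strict past of a sequence. -/
def strictPast {Ω Z : Type*} {mΩ : MeasurableSpace Ω} [MeasurableSpace Z] (ξ : ℕ → Ω → Z)
    (hξ : ∀ k, Measurable (ξ k)) : Filtration ℕ mΩ where
  seq k := ⨆ j ∈ Set.Iio k, MeasurableSpace.comap (ξ j) inferInstance
  mono' _ _ hij := biSup_mono fun _ hk => lt_of_lt_of_le hk hij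
  le' _ := iSup₂_le fun j _ => (hξ j).comap_le

/-- Robbins–Siegmund for a recursion driven by independent, identically distributed draws. -/
theorem robbinsSiegmund_of_recursion {Ω X Z : Type*} [MeasurableSpace Ω] [MeasurableSpace X]
    [MeasurableSpace Z] {μ : Measure Ω} [IsProbabilityMeasure μ] {ν : Measure Z}
    {ξ : ℕ → Ω → Z} (hξ : ∀ k, Measurable (ξ k)) (hlaw : ∀ k, μ.map (ξ k) = ν)
    (hind : iIndepFun ξ μ) {T : ℕ → Z → X → X} (hT : ∀ k, Measurable (Function.uncurry (T k)))
    {x : ℕ → Ω → X} {x₀ : X} (hx0 : ∀ ω, x 0 ω = x₀)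
    (hx : ∀ k ω, x (k + 1) ω = T k (ξ k ω) (x k ω))
    {V : X → ℝ} {U : ℕ → X → ℝ} (hVm : Measurable V) (hUm : ∀ k, Measurable (U k))
    (hV : ∀ y, 0 ≤ V y) (hU : ∀ k y, 0 ≤ U k y) {a b : ℕ → ℝ}
    (ha : ∀ k, 0 ≤ a k) (hb : ∀ k, 0 ≤ b k) (has : Summable a) (hbs : Summable b)
    (h : ∀ k y, ∫⁻ z, ENNReal.ofReal (V (T k z y)) ∂ν + ENNReal.ofReal (U k y) ≤
      ENNReal.ofReal ((1 + a k) * V y + b k)) :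
    ∀ᵐ ω ∂μ, (∃ L, Tendsto (fun k => V (x k ω)) atTop (𝓝 L)) ∧
      Summable fun k => U k (x k ω) := by
  set ℱ := strictPast ξ hξ with hℱ
  -- `x k` depends only on the draws with index below `k`, which are those in `ℱ k`; the draw `ξ k`
  -- is independent of them.
  have hxm : ∀ k, Measurable[ℱ k] (x k) := by
    intro k
    induction k with
    | zero => rw [show x 0 = fun _ => x₀ from funext hx0]; exact measurable_const
    | succ k ih =>
      rw [show x (k + 1) = fun ω => Function.uncurry (T k) (ξ k ω, x k ω) from funext (hx k)]
      refine (hT k).comp (Measurable.prodMk ?_ (ih.mono (ℱ.mono k.le_succ) le_rfl))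
      refine (comap_measurable (ξ k)).mono ?_ le_rfl
      exact le_biSup (fun j => MeasurableSpace.comap (ξ j) inferInstance)
        (show k ∈ Set.Iio (k + 1) from k.lt_succ_self)
  have hxm' : ∀ k, Measurable (x k) := fun k => (hxm k).mono (ℱ.le k) le_rfl
  have hindep : ∀ k, Indep (ℱ k) (MeasurableSpace.comap (ξ k) inferInstance) μ := by
    intro k
    have := indep_iSup_of_disjoint (fun j => (hξ j).comap_le) hind.iIndep
      (S := Set.Iio k) (T := {k}) (by simp)
    rw [iSup_singleton] at this
    exact this
  have hdrift : ∀ k s, MeasurableSet[ℱ k] s →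
      ∫⁻ ω in s, ENNReal.ofReal (V (x (k + 1) ω)) ∂μ + ∫⁻ ω in s, ENNReal.ofReal (U k (x k ω)) ∂μ ≤
        ∫⁻ ω in s, ENNReal.ofReal ((1 + a k) * V (x k ω) + b k) ∂μ := by
    intro k s hs
    simp_rw [hx]
    rw [setLIntegral_comp_of_indep (ℱ.le k) (hξ k) (hxm k) (hindep k) hs
      (W := fun z y => ENNReal.ofReal (V (T k z y))) ((hVm.comp (hT k)).ennreal_ofReal), hlaw,
      ← lintegral_add_right _
        (show Measurable fun ω => ENNReal.ofReal (U k (x k ω)) from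
          ((hUm k).comp (hxm' k)).ennreal_ofReal)]
    exact lintegral_mono fun ω => h k (x k ω)
  have hVx0 : ∀ k ω, 0 ≤ (1 + a k) * V (x k ω) + b k := fun k ω =>
    add_nonneg (mul_nonneg (by linarith [ha k]) (hV _)) (hb k)
  -- The drift in `ℝ≥0∞` needs no integrability and propagates it from the constant `x 0`.
  have hVi : ∀ k, Integrable (fun ω => V (x k ω)) μ := by
    intro k
    induction k with
    | zero => simp_rw [hx0]; exact integrable_const _
    | succ k ih =>
      refine ⟨(hVm.comp (hxm' _)).aestronglyMeasurable, ?_⟩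
      rw [hasFiniteIntegral_iff_ofReal (ae_of_all _ fun ω => hV _)]
      have h1 := hdrift k Set.univ MeasurableSet.univ
      simp only [Measure.restrict_univ] at h1
      have h2 : Integrable (fun ω => (1 + a k) * V (x k ω) + b k) μ :=
        (ih.const_mul _).add (integrable_const _)
      exact (le_self_add.trans h1).trans_lt
        ((hasFiniteIntegral_iff_ofReal (ae_of_all _ (hVx0 k))).1 h2.2)
  have hRi : ∀ k, Integrable (fun ω => (1 + a k) * V (x k ω) + b k) μ := fun k =>
    ((hVi k).const_mul _).add (integrable_const _)
  have hUi : ∀ k, Integrable (fun ω => U k (x k ω)) μ := by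
    intro k
    refine ⟨((hUm k).comp (hxm' _)).aestronglyMeasurable, ?_⟩
    rw [hasFiniteIntegral_iff_ofReal (ae_of_all _ fun ω => hU k _)]
    have h1 := hdrift k Set.univ MeasurableSet.univ
    simp only [Measure.restrict_univ] at h1
    exact (le_add_self.trans h1).trans_lt
      ((hasFiniteIntegral_iff_ofReal (ae_of_all _ (hVx0 k))).1 (hRi k).2)
  refine robbinsSiegmund ℱ (V := fun k ω => V (x k ω)) (U := fun k ω => U k (x k ω))
    (fun k => (hVm.comp (hxm k)).stronglyMeasurable) (fun k ω => hV _) (fun k ω => hU k _)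
    hVi hUi ha hb has hbs fun k s hs => ?_
  have h1 := hdrift k s hs
  rw [← ofReal_integral_eq_lintegral_ofReal (hVi _).integrableOn (ae_of_all _ fun ω => hV _),
    ← ofReal_integral_eq_lintegral_ofReal (hUi _).integrableOn (ae_of_all _ fun ω => hU k _),
    ← ofReal_integral_eq_lintegral_ofReal (hRi _).integrableOn (ae_of_all _ (hVx0 k)),
    ← ENNReal.ofReal_add (integral_nonneg fun ω => hV _) (integral_nonneg fun ω => hU k _),
    ENNReal.ofReal_le_ofReal_iff (integral_nonneg (hVx0 k))] at h1
  exact h1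

/-! ### Geometry of averaging and gradient steps -/

/-- In finite dimension a linear map is dominated by every linear map with a smaller kernel. -/
lemma exists_norm_le_mul_norm_of_ker_le {E F H : Type*} [NormedAddCommGroup E] [NormedSpace ℝ E]
    [NormedAddCommGroup F] [NormedSpace ℝ F] [FiniteDimensional ℝ F]
    [NormedAddCommGroup H] [NormedSpace ℝ H] {T : E →ₗ[ℝ] F} {Q : E →ₗ[ℝ] H}
    (h : LinearMap.ker T ≤ LinearMap.ker Q) : ∃ C, ∀ x, ‖Q x‖ ≤ C * ‖T x‖ := by
  -- With a section `r` of `T` over its range, `x - r (T x)` lies in `ker T ≤ ker Q`, so `Q = Q ∘ r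
  -- ∘ T`; the map `Q ∘ r` is bounded because the range is finite-dimensional.
  obtain ⟨r, hr⟩ := T.rangeRestrict.exists_rightInverse_of_surjective T.range_rangeRestrict
  set L := LinearMap.toContinuousLinearMap (Q ∘ₗ r)
  refine ⟨‖L‖, fun x => ?_⟩
  have h1 : x - r (T.rangeRestrict x) ∈ LinearMap.ker T := by
    have h2 := congrArg Subtype.val (LinearMap.congr_fun hr (T.rangeRestrict x))
    rw [LinearMap.mem_ker, map_sub, sub_eq_zero]
    exact h2.symm
  have h2 : Q x = L (T.rangeRestrict x) := by
    have := h h1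
    rwa [LinearMap.mem_ker, map_sub, sub_eq_zero] at this
  rw [h2]
  exact L.le_opNorm _

namespace AsyncSGD

/-- Every node receives the variable of node `i`: a linear projection onto the consensus space. -/
noncomputable def copyNode {N d : ℕ} (i : Fin N) : NetVar N d →ₗ[ℝ] NetVar N d where
  toFun β := WithLp.toLp 2 fun _ => β i
  map_add' _ _ := by ext; simp
  map_smul' _ _ := by ext; simp

@[simp] lemma copyNode_apply {N d : ℕ} (i j : Fin N) (β : NetVar N d) :
    copyNode i β j = β i := rfl

lemma copyNode_mem_feasibleSet {N d : ℕ} (G : SimpleGraph (Fin N)) (i : Fin N) (β : NetVar N d) :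
    copyNode i β ∈ feasibleSet d G :=
  Set.mem_iInter.2 fun _ _ _ => rfl

/-- Neighbourhood averaging as a linear map. -/
noncomputable def averagingLin {N : ℕ} (d : ℕ) (G : SimpleGraph (Fin N)) [DecidableRel G.Adj]
    (m : Fin N) : NetVar N d →ₗ[ℝ] NetVar N d where
  toFun β := averagingStep G m β
  map_add' β γ := by
    ext j : 1
    by_cases h : j ∈ insert m (G.neighborFinset m)
    · simp only [averagingStep, PiLp.add_apply, h, if_true, Finset.sum_add_distrib, smul_add]
    · simp only [averagingStep, PiLp.add_apply, h, if_false]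
  map_smul' c β := by
    ext j : 1
    by_cases h : j ∈ insert m (G.neighborFinset m)
    · simp only [averagingStep, PiLp.smul_apply, h, if_true, ← Finset.smul_sum, RingHom.id_apply]
      rw [smul_comm]
    · simp only [averagingStep, PiLp.smul_apply, h, if_false, RingHom.id_apply]

lemma apply_eq_of_forall_adj {N d : ℕ} {G : SimpleGraph (Fin N)} (hG : G.Connected)
    {β : NetVar N d} (hβ : ∀ i j, G.Adj i j → β i = β j) (i j : Fin N) : β i = β j := by
  obtain ⟨p⟩ := hG.preconnected i j
  induction p with
  | nil => rfl
  | cons h _ ih => exact (hβ _ _ h).trans ih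

/-- A point fixed by all averaging maps is constant on every closed neighbourhood, hence a consensus
point by connectedness. The joint kernel of the maps `id - A_m` thus lies in that of `id - copyNode
i`, and kernel inclusion yields a quantitative bound. -/
lemma exists_linear_regularity {N : ℕ} (d : ℕ) {G : SimpleGraph (Fin N)} [DecidableRel G.Adj]
    (hG : G.Connected) (i : Fin N) :
    ∃ κ > 0, ∀ β : NetVar N d,
      κ * ‖β - copyNode i β‖ ^ 2 ≤ ∑ m, ‖β - averagingStep G m β‖ ^ 2 := by
  set T : NetVar N d →ₗ[ℝ] (Fin N → NetVar N d) :=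
    LinearMap.pi fun m => LinearMap.id - averagingLin d G m with hT
  set Q : NetVar N d →ₗ[ℝ] NetVar N d := LinearMap.id - copyNode i with hQ
  have hker : LinearMap.ker T ≤ LinearMap.ker Q := by
    intro β hβ
    rw [LinearMap.mem_ker] at hβ ⊢
    have h1 : ∀ m, β = averagingStep G m β := fun m => sub_eq_zero.1 (congrFun hβ m)
    have h2 : ∀ i j, G.Adj i j → β i = β j := by
      intro i j hij
      have e1 := congrArg (fun γ : NetVar N d => γ i) (h1 i)
      have e2 := congrArg (fun γ : NetVar N d => γ j) (h1 i)
      simp only [averagingStep] at e1 e2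
      rw [if_pos (by simp)] at e1
      rw [if_pos (by simp [hij])] at e2
      exact e1.trans e2.symm
    have h3 := apply_eq_of_forall_adj hG h2
    refine sub_eq_zero.2 ?_
    ext j : 1
    exact h3 j i
  obtain ⟨C, hC⟩ := exists_norm_le_mul_norm_of_ker_le hker
  -- The `+ 1` covers the case `C = 0`.
  refine ⟨1 / (C ^ 2 + 1), by positivity, fun β => ?_⟩
  have hD0 : 0 ≤ ∑ m, ‖β - averagingStep G m β‖ ^ 2 := by positivity
  have h1 : ‖T β‖ ≤ Real.sqrt (∑ m, ‖β - averagingStep G m β‖ ^ 2) := by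
    refine (pi_norm_le_iff_of_nonneg (Real.sqrt_nonneg _)).2 fun m => ?_
    refine Real.le_sqrt_of_sq_le ?_
    exact Finset.single_le_sum (f := fun m => ‖β - averagingStep G m β‖ ^ 2)
      (fun _ _ => by positivity) (Finset.mem_univ m)
  have h2 : ‖β - copyNode i β‖ ≤ C * ‖T β‖ := hC β
  have h3 : ‖β - copyNode i β‖ ^ 2 ≤ C ^ 2 * ∑ m, ‖β - averagingStep G m β‖ ^ 2 := by
    calc _ ≤ (C * ‖T β‖) ^ 2 := by gcongr
      _ = C ^ 2 * ‖T β‖ ^ 2 := by ring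
      _ ≤ C ^ 2 * Real.sqrt (∑ m, ‖β - averagingStep G m β‖ ^ 2) ^ 2 := by gcongr
      _ = _ := by rw [Real.sq_sqrt hD0]
  rw [one_div, inv_mul_le_iff₀ (by positivity)]
  linarith

/-- The residual vanishes off the neighbourhood and sums to zero on it, while the other factor is
constant there because `b` is a consensus point. -/
lemma inner_averagingStep {N d : ℕ} (G : SimpleGraph (Fin N)) [DecidableRel G.Adj] (m : Fin N)
    (β b : NetVar N d) (hb : ∀ i j, b i = b j) :
    inner ℝ (averagingStep G m β - b) (β - averagingStep G m β) = (0 : ℝ) := by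
  set s := insert m (G.neighborFinset m) with hs
  set c := (1 / (1 + (G.degree m : ℝ))) • ∑ k ∈ s, β k with hc
  have hcard : (s.card : ℝ) = 1 + G.degree m := by
    rw [hs, Finset.card_insert_of_notMem (by simp)]
    simp [add_comm]
  rw [PiLp.inner_apply]
  have : ∀ j, inner ℝ ((averagingStep G m β - b) j) ((β - averagingStep G m β) j) =
      if j ∈ s then inner ℝ (c - b m) (β j - c) else (0 : ℝ) := by
    intro j
    by_cases h : j ∈ s
    · simp only [averagingStep, PiLp.sub_apply, ← hs, h, if_true, hb j m, ← hc]
    · simp only [averagingStep, PiLp.sub_apply, ← hs, h, if_false, sub_self, inner_zero_right]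
  rw [Finset.sum_congr rfl fun j _ => this j, Finset.sum_ite_mem, Finset.univ_inter,
    ← inner_sum, Finset.sum_sub_distrib, Finset.sum_const, ← Nat.cast_smul_eq_nsmul ℝ, hcard, hc,
    smul_smul, mul_one_div_cancel (by positivity), one_smul, sub_self, inner_zero_right]

/-- Averaging is an orthogonal projection: Pythagoras relative to any consensus point. -/
lemma norm_averagingStep_sub_sq {N d : ℕ} (G : SimpleGraph (Fin N)) [DecidableRel G.Adj]
    (m : Fin N) (β b : NetVar N d) (hb : ∀ i j, b i = b j) :
    ‖averagingStep G m β - b‖ ^ 2 = ‖β - b‖ ^ 2 - ‖β - averagingStep G m β‖ ^ 2 := by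
  have h := norm_add_sq_real (averagingStep G m β - b) (β - averagingStep G m β)
  rw [inner_averagingStep G m β b hb] at h
  rw [show averagingStep G m β - b + (β - averagingStep G m β) = β - b by abel] at h
  linarith

lemma norm_gradientStep_sub_sq {N d : ℕ} {S : Type*}
    (g : Fin N → LocalVar d → S → LocalVar d) (a : ℝ) (m : Fin N) (v : S) (β b : NetVar N d) :
    ‖gradientStep g a m v β - b‖ ^ 2 = ‖β - b‖ ^ 2
      - 2 * (a / N) * inner ℝ (g m (β m) v) (β m - b m) + (a / N) ^ 2 * ‖g m (β m) v‖ ^ 2 := by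
  have : ∀ j, ‖(gradientStep g a m v β - b) j‖ ^ 2 = ‖(β - b) j‖ ^ 2 + if j = m then
      - 2 * (a / N) * inner ℝ (g m (β m) v) (β m - b m) + (a / N) ^ 2 * ‖g m (β m) v‖ ^ 2
      else 0 := by
    intro j
    by_cases h : j = m
    · subst h
      simp only [gradientStep, PiLp.sub_apply, if_true]
      rw [show β j - (a * (1 / (N : ℝ))) • g j (β j) v - b j
        = (β j - b j) - (a / N) • g j (β j) v by rw [mul_one_div]; abel, norm_sub_sq_real,
        inner_smul_right, norm_smul, mul_pow, Real.norm_eq_abs, sq_abs, real_inner_comm]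
      ring
    · simp only [gradientStep, PiLp.sub_apply, h, if_false, add_zero]
  rw [PiLp.norm_sq_eq_of_L2, PiLp.norm_sq_eq_of_L2, Finset.sum_congr rfl fun j _ => this j,
    Finset.sum_add_distrib, Finset.sum_ite_eq' Finset.univ m]
  simp only [Finset.mem_univ, if_true]
  ring

/-! ### Means and second moments of the oracle -/

section Oracle

variable {d : ℕ} {S : Type*} [MeasurableSpace S] {P : Measure S}

lemma integral_inner_const {f : S → LocalVar d} (hf : Integrable f P) (y : LocalVar d) :
    ∫ v, (inner ℝ (f v) y : ℝ) ∂P = inner ℝ (∫ v, f v ∂P) y := by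
  rw [real_inner_comm, ← integral_inner hf]
  exact integral_congr_ae (ae_of_all _ fun v => real_inner_comm _ _)

/-- Integrating the samplewise subgradient inequality reduces the first kind of oracle to the
second. -/
lemma IsSubgradientOracle.hasSubgradientAt_integral {l : LocalVar d → S → ℝ}
    {g : LocalVar d → S → LocalVar d} (hg : IsSubgradientOracle P l g)
    (hl : ∀ x, Integrable (l x) P) {x : LocalVar d} (hgi : Integrable (g x) P) :
    HasSubgradientAt (expectedLoss P l) (∫ v, g x v ∂P) x := by
  rcases hg with h | h
  · intro y
    have hi : Integrable (fun v => (inner ℝ (g x v) (y - x) : ℝ)) P := hgi.inner_const _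
    rw [← integral_inner_const hgi, expectedLoss, expectedLoss, ← integral_add (hl x) hi]
    refine integral_mono_ae ((hl x).add hi) (hl y) ?_
    filter_upwards [h x] with v hv using hv y
  · exact h x

/-- The variance is nonnegative. -/
lemma norm_integral_sq_le [IsProbabilityMeasure P] {f : S → LocalVar d} (hf : Integrable f P)
    (hf2 : Integrable (fun v => ‖f v‖ ^ 2) P) : ‖∫ v, f v ∂P‖ ^ 2 ≤ ∫ v, ‖f v‖ ^ 2 ∂P := by
  set s := ∫ v, f v ∂P with hs
  have h0 : 0 ≤ ∫ v, ‖f v - s‖ ^ 2 ∂P := integral_nonneg fun v => by positivity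
  have hi : Integrable (fun v => (inner ℝ (f v) s : ℝ)) P := hf.inner_const _
  have e : ∫ v, ‖f v - s‖ ^ 2 ∂P = ∫ v, ‖f v‖ ^ 2 ∂P - 2 * ‖s‖ ^ 2 + ‖s‖ ^ 2 := by
    simp_rw [norm_sub_sq_real]
    have hi2 : Integrable (fun v => ‖f v‖ ^ 2 - 2 * (inner ℝ (f v) s : ℝ)) P :=
      hf2.sub (hi.const_mul 2)
    rw [integral_add hi2 (integrable_const _), integral_sub hf2 (hi.const_mul 2), integral_const_mul]
    have : ∫ v, (inner ℝ (f v) s : ℝ) ∂P = ‖s‖ ^ 2 := by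
      rw [integral_inner_const hf, ← hs, real_inner_self_eq_norm_sq]
    rw [this]
    simp
  linarith

lemma integrable_of_integrable_norm_sq [IsFiniteMeasure P] {f : S → LocalVar d} (hf : Measurable f)
    (hf2 : Integrable (fun v => ‖f v‖ ^ 2) P) : Integrable f P :=
  ((memLp_two_iff_integrable_sq_norm hf.aestronglyMeasurable).2 hf2).integrable (by norm_num)

end Oracle

end AsyncSGD

/-! ### The law, measurability and mean effect of one iteration -/

namespace AsyncSGD

lemma lintegral_drawLaw {N : ℕ} {S : Type*} [MeasurableSpace S] {P : Fin N → Measure S}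
    [∀ i, IsProbabilityMeasure (P i)] {F : Fin N × ℝ × S → ℝ≥0∞} (hF : Measurable F)
    {A : Fin N → S → ℝ≥0∞} {B : Fin N → ℝ≥0∞}
    (h : ∀ i r v, F (i, r, v) = if r ≤ 1 / 2 then A i v else B i) :
    ∫⁻ z, F z ∂(drawLaw P) = ∑ i, (N : ℝ≥0∞)⁻¹ * (ENNReal.ofReal (1 / 2) * ∫⁻ v, A i v ∂(P i)
      + ENNReal.ofReal (1 / 2) * B i) := by
  rw [drawLaw, lintegral_finsetSum_measure]
  refine Finset.sum_congr rfl fun i _ => ?_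
  rw [lintegral_smul_measure, smul_eq_mul]
  congr 1
  rw [lintegral_prod _ hF.aemeasurable, lintegral_dirac' _ hF.lintegral_prod_right',
    lintegral_prod (fun y => F (i, y)) (hF.comp measurable_prodMk_left).aemeasurable]
  have e : ∀ r, ∫⁻ v, F (i, r, v) ∂(P i) =
      (Set.Iic (1 / 2 : ℝ)).indicator (fun _ => ∫⁻ v, A i v ∂(P i)) r +
      (Set.Ioi (1 / 2 : ℝ)).indicator (fun _ => B i) r := by
    intro r
    by_cases hr : r ≤ 1 / 2
    · simp [h, hr, -one_div]
    · have : 1 / 2 < r := not_le.1 hr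
      simp [h, hr, this, -one_div]
  simp_rw [e]
  rw [lintegral_add_left (measurable_const.indicator measurableSet_Iic),
    lintegral_indicator measurableSet_Iic, lintegral_indicator measurableSet_Ioi,
    lintegral_const, lintegral_const, Measure.restrict_restrict measurableSet_Iic,
    Measure.restrict_restrict measurableSet_Ioi, Measure.restrict_apply_univ,
    Measure.restrict_apply_univ]
  have e1 : Set.Iic (1 / 2 : ℝ) ∩ Set.Icc 0 1 = Set.Icc 0 (1 / 2) := by
    ext r; simp only [Set.mem_inter_iff, Set.mem_Iic, Set.mem_Icc]
    constructor <;> intro h <;> refine ⟨?_, ?_⟩ <;> grind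
  have e2 : Set.Ioi (1 / 2 : ℝ) ∩ Set.Icc 0 1 = Set.Ioc (1 / 2) 1 := by
    ext r; simp only [Set.mem_inter_iff, Set.mem_Ioi, Set.mem_Icc, Set.mem_Ioc]
    constructor <;> intro h <;> refine ⟨?_, ?_⟩ <;> grind
  rw [e1, e2, Real.volume_Icc, Real.volume_Ioc, mul_comm, mul_comm (B i)]
  norm_num

section Measurability

variable {N d : ℕ} {S : Type*} [MeasurableSpace S]

lemma measurable_step (G : SimpleGraph (Fin N)) [DecidableRel G.Adj]
    {g : Fin N → LocalVar d → S → LocalVar d} (hg : ∀ i, Measurable (Function.uncurry (g i)))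
    (a : ℝ) : Measurable (Function.uncurry (step G g a)) := by
  have hcoord : ∀ j : Fin N, Measurable fun β : NetVar N d => β j := fun j =>
    (PiLp.continuous_apply 2 _ j).measurable
  have h1 : ∀ m, Measurable fun p : S × NetVar N d => gradientStep g a m p.1 p.2 := by
    intro m
    refine (PiLp.continuous_toLp 2 _).measurable.comp (measurable_pi_lambda _ fun j => ?_)
    have hgm : Measurable fun p : S × NetVar N d => g m (p.2 m) p.1 :=
      (hg m).comp (((hcoord m).comp measurable_snd).prodMk measurable_fst)
    by_cases h : j = m
    · simp only [h, if_true]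
      exact ((hcoord m).comp measurable_snd).sub (hgm.const_smul (a * (1 / (N : ℝ))))
    · simp only [h, if_false]
      exact (hcoord j).comp measurable_snd
  have h2 : ∀ m, Measurable fun β : NetVar N d => averagingStep G m β := by
    intro m
    refine (PiLp.continuous_toLp 2 _).measurable.comp (measurable_pi_lambda _ fun j => ?_)
    by_cases h : j ∈ insert m (G.neighborFinset m)
    · simp only [h, if_true]
      have hs : Measurable fun β : NetVar N d => ∑ k ∈ insert m (G.neighborFinset m), β k :=
        Finset.measurable_fun_sum _ fun k _ => hcoord k
      exact hs.const_smul (1 / (1 + (G.degree m : ℝ)))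
    · simp only [h, if_false]
      exact hcoord j
  have h3 : ∀ m, Measurable fun p : (ℝ × S) × NetVar N d => step G g a (m, p.1) p.2 := by
    intro m
    refine Measurable.ite (measurableSet_le (measurable_fst.comp measurable_fst) measurable_const)
      ((h1 m).comp ((measurable_snd.comp measurable_fst).prodMk measurable_snd))
      ((h2 m).comp measurable_snd)
  have h4 : Measurable fun q : Fin N × ((ℝ × S) × NetVar N d) => step G g a (q.1, q.2.1) q.2.2 :=
    measurable_from_prod_countable_right h3
  exact h4.comp ((measurable_fst.comp measurable_fst).prodMk
    ((measurable_snd.comp measurable_fst).prodMk measurable_snd))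

/-- Continuity makes limits of asymptotically optimal feasible points optimal. The drift estimate
itself rests on the subgradient inequality alone. -/
lemma continuous_expectedLoss {P : Measure S} {l : LocalVar d → S → ℝ}
    (h : ConvexOn ℝ Set.univ (expectedLoss P l)) : Continuous (expectedLoss P l) :=
  continuousOn_univ.1 (h.continuousOn isOpen_univ)

lemma continuous_objective {P : Fin N → Measure S} {l : Fin N → LocalVar d → S → ℝ}
    (h : ∀ i, ConvexOn ℝ Set.univ (expectedLoss (P i) (l i))) : Continuous (objective P l) :=
  continuous_const.mul (continuous_finsetSum _ fun i _ =>
    (continuous_expectedLoss (h i)).comp (PiLp.continuous_apply 2 _ i))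

end Measurability

lemma isClosed_feasibleSet {N d : ℕ} (G : SimpleGraph (Fin N)) : IsClosed (feasibleSet d G) := by
  refine isClosed_iInter fun n => ?_
  simp only [localConsensus, Set.ofPred_forall]
  exact isClosed_iInter fun k => isClosed_iInter fun _ =>
    isClosed_eq (PiLp.continuous_apply 2 _ n) (PiLp.continuous_apply 2 _ k)

/-- Mean square distance to a consensus point after one iteration. -/
lemma lintegral_norm_step_sub_sq {N d : ℕ} (hN : 0 < N) (G : SimpleGraph (Fin N))
    [DecidableRel G.Adj] {S : Type*} [MeasurableSpace S] (P : Fin N → Measure S)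
    [∀ i, IsProbabilityMeasure (P i)] {g : Fin N → LocalVar d → S → LocalVar d}
    (hgm : ∀ i, Measurable (Function.uncurry (g i)))
    (hg2 : ∀ i x, Integrable (fun v => ‖g i x v‖ ^ 2) (P i))
    {b : NetVar N d} (hb : ∀ i j, b i = b j) (a : ℝ) (β : NetVar N d) :
    ∃ X : ℝ, 0 ≤ X ∧
      ∫⁻ z, ENNReal.ofReal (‖step G g a z β - b‖ ^ 2) ∂(drawLaw P) = ENNReal.ofReal X ∧
      X = ‖β - b‖ ^ 2
      - (a / N) * ((1 / N) * ∑ i, inner ℝ (∫ v, g i (β i) v ∂(P i)) (β i - b i))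
      + (a / N) ^ 2 / 2 * ((1 / N) * ∑ i, ∫ v, ‖g i (β i) v‖ ^ 2 ∂(P i))
      - (1 / 2) * ((1 / N) * ∑ i, ‖β - averagingStep G i β‖ ^ 2) := by
  have hNr : (0 : ℝ) < N := Nat.cast_pos.2 hN
  have hgx : ∀ i x, Measurable (g i x) := fun i x => (hgm i).comp measurable_prodMk_left
  have hgi : ∀ i x, Integrable (g i x) (P i) := fun i x =>
    integrable_of_integrable_norm_sq (hgx i x) (hg2 i x)
  set A : Fin N → S → ℝ := fun i v => ‖gradientStep g a i v β - b‖ ^ 2 with hA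
  set B : Fin N → ℝ := fun i => ‖averagingStep G i β - b‖ ^ 2 with hB
  have hA' : ∀ i, A i = fun v => ‖β - b‖ ^ 2 - 2 * (a / N) * inner ℝ (g i (β i) v) (β i - b i)
      + (a / N) ^ 2 * ‖g i (β i) v‖ ^ 2 := fun i =>
    funext fun v => norm_gradientStep_sub_sq g a i v β b
  have hA0 : ∀ i v, 0 ≤ A i v := fun i v => by positivity
  have hB0 : ∀ i, 0 ≤ B i := fun i => by positivity
  have hstep := measurable_step G hgm a
  have hF : Measurable fun z => ENNReal.ofReal (‖step G g a z β - b‖ ^ 2) :=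
    (((hstep.comp measurable_prodMk_right).sub_const b).norm.pow_const 2).ennreal_ofReal
  have hin : ∀ i, Integrable
      (fun v => (2 * (a / N) * inner ℝ (g i (β i) v) (β i - b i) : ℝ)) (P i) := fun i =>
    ((hgi i (β i)).inner_const _).const_mul _
  have hAi : ∀ i, Integrable (A i) (P i) := fun i => by
    rw [hA' i]
    exact ((integrable_const _).sub (hin i)).add ((hg2 i _).const_mul _)
  have hAint : ∀ i, ∫ v, A i v ∂(P i) = ‖β - b‖ ^ 2
      - 2 * (a / N) * inner ℝ (∫ v, g i (β i) v ∂(P i)) (β i - b i)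
      + (a / N) ^ 2 * ∫ v, ‖g i (β i) v‖ ^ 2 ∂(P i) := fun i => by
    have hi2 : Integrable (fun v => ‖β - b‖ ^ 2
        - (2 * (a / N) * inner ℝ (g i (β i) v) (β i - b i) : ℝ)) (P i) :=
      (integrable_const _).sub (hin i)
    rw [hA' i, integral_add hi2 ((hg2 i _).const_mul _), integral_sub (integrable_const _) (hin i),
      integral_const_mul, integral_const_mul]
    rw [integral_inner_const (hgi i _)]
    simp
  have hI : ∀ i, 0 ≤ 1 / 2 * ∫ v, A i v ∂(P i) + 1 / 2 * B i := fun i =>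
    add_nonneg (mul_nonneg (by norm_num) (integral_nonneg (hA0 i)))
      (mul_nonneg (by norm_num) (hB0 i))
  have hsum0 : ∀ i, 0 ≤ (1 / N : ℝ) * (1 / 2 * ∫ v, A i v ∂(P i) + 1 / 2 * B i) := fun i =>
    mul_nonneg (by positivity) (hI i)
  -- In this form nonnegativity is evident, which is what passing through `ENNReal.ofReal` needs;
  -- the squares are expanded only in the last goal.
  refine ⟨∑ i, (1 / N) * (1 / 2 * ∫ v, A i v ∂(P i) + 1 / 2 * B i),
    Finset.sum_nonneg fun i _ => hsum0 i, ?_, ?_⟩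
  · have hterm : ∀ i, (N : ℝ≥0∞)⁻¹ * (ENNReal.ofReal (1 / 2) *
        ∫⁻ v, ENNReal.ofReal (A i v) ∂(P i) + ENNReal.ofReal (1 / 2) * ENNReal.ofReal (B i)) =
        ENNReal.ofReal ((1 / N) * (1 / 2 * ∫ v, A i v ∂(P i) + 1 / 2 * B i)) := by
      intro i
      rw [← ofReal_integral_eq_lintegral_ofReal (hAi i) (ae_of_all _ (hA0 i)),
        ← ENNReal.ofReal_mul (by norm_num), ← ENNReal.ofReal_mul (by norm_num),
        ← ENNReal.ofReal_add (mul_nonneg (by norm_num) (integral_nonneg (hA0 i)))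
          (mul_nonneg (by norm_num) (hB0 i)),
        ENNReal.ofReal_mul (by positivity), one_div (N : ℝ), ENNReal.ofReal_inv_of_pos hNr,
        ENNReal.ofReal_natCast]
    rw [lintegral_drawLaw (A := fun i v => ENNReal.ofReal (A i v))
        (B := fun i => ENNReal.ofReal (B i)) hF,
      Finset.sum_congr rfl fun i _ => hterm i, ← ENNReal.ofReal_sum_of_nonneg fun i _ => hsum0 i]
    intro i r v
    by_cases hr : r ≤ 1 / 2
    · simp only [step, hr, if_true, hA]
    · simp only [step, hr, if_false, hB]
  · simp_rw [hAint, hB, norm_averagingStep_sub_sq G _ β b hb]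
    rw [← Finset.mul_sum]
    simp only [Finset.sum_add_distrib, ← Finset.mul_sum, Finset.sum_sub_distrib,
      Finset.sum_const, Finset.card_univ, Fintype.card_fin, nsmul_eq_mul]
    field_simp
    ring

end AsyncSGD

/-! ### The drift inequality -/

namespace AsyncSGD

lemma mean_growth_le {N d : ℕ} (hN : 0 < N) {σ : ℝ} (hσ : 0 ≤ σ) (β : NetVar N d) :
    (1 / N : ℝ) * ∑ i, σ * (1 + ‖β i‖ ^ 2) ≤ σ * (1 + ‖β‖ ^ 2) := by
  have hN1 : (1 : ℝ) ≤ N := Nat.one_le_cast.2 hN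
  rw [← Finset.mul_sum, Finset.sum_add_distrib, ← PiLp.norm_sq_eq_of_L2]
  simp only [Finset.sum_const, Finset.card_univ, Fintype.card_fin, nsmul_eq_mul, mul_one]
  rw [one_div, inv_mul_le_iff₀ (by linarith)]
  nlinarith [mul_nonneg (mul_nonneg hσ (sq_nonneg ‖β‖)) (sub_nonneg.2 hN1)]

/-- Quadratic growth of the mean square error, with the descent in the consensus error and in the
optimality gap. -/
lemma exists_drift {N d : ℕ} {G : SimpleGraph (Fin N)} [DecidableRel G.Adj] (hG : G.Connected)
    (n₀ : Fin N) {S : Type*} [MeasurableSpace S] {P : Fin N → Measure S}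
    [∀ i, IsProbabilityMeasure (P i)] {l : Fin N → LocalVar d → S → ℝ}
    {g : Fin N → LocalVar d → S → LocalVar d} (hl : ∀ i x, Integrable (l i x) (P i))
    (hgm : ∀ i, Measurable (Function.uncurry (g i)))
    (hg : ∀ i, IsSubgradientOracle (P i) (l i) (g i)) {σ : ℝ}
    (hσ : ∀ i x, Integrable (fun v => ‖g i x v‖ ^ 2) (P i) ∧
      ∫ v, ‖g i x v‖ ^ 2 ∂(P i) ≤ σ * (1 + ‖x‖ ^ 2)) {b : NetVar N d}
    (hb : b ∈ optimalSet G P l) :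
    ∃ κ > 0, ∃ C ≥ 0, ∀ a, 0 ≤ a → ∀ β : NetVar N d,
      ∫⁻ z, ENNReal.ofReal (‖step G g a z β - b‖ ^ 2) ∂(drawLaw P) +
        ENNReal.ofReal (κ * ‖β - copyNode n₀ β‖ ^ 2 +
          a / N * (objective P l (copyNode n₀ β) - objective P l b)) ≤
      ENNReal.ofReal ((1 + C * a ^ 2) * ‖β - b‖ ^ 2 + C * a ^ 2) := by
  have hN : 0 < N := n₀.pos
  have hNr : (0 : ℝ) < N := Nat.cast_pos.2 hN
  have hN1 : (1 : ℝ) ≤ N := Nat.one_le_cast.2 hN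
  have hσ0 : 0 ≤ σ := by
    have h1 := (hσ n₀ 0).2
    have h2 : 0 ≤ ∫ v, ‖g n₀ 0 v‖ ^ 2 ∂(P n₀) := integral_nonneg fun v => by positivity
    simp only [norm_zero] at h1
    linarith
  obtain ⟨κ, hκ, hreg⟩ := exists_linear_regularity d hG n₀
  have hbc : ∀ i j, b i = b j :=
    apply_eq_of_forall_adj hG fun i j hij => Set.mem_iInter.1 hb.1 i j hij
  have hgi : ∀ i x, Integrable (g i x) (P i) := fun i x =>
    integrable_of_integrable_norm_sq ((hgm i).comp measurable_prodMk_left) (hσ i x).1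
  have hsub : ∀ i x, HasSubgradientAt (expectedLoss (P i) (l i)) (∫ v, g i x v ∂(P i)) x :=
    fun i x => (hg i).hasSubgradientAt_integral (hl i) (hgi i x)
  -- Regularity yields a descent of `κ / (2 * N)` times the squared consensus error; half is spent
  -- on the Young term. In `C`, `1 / κ` comes from Young, `1 / 2` from the second moment of the
  -- gradient step, and `2 * (1 + ‖b‖ ^ 2)` from replacing `‖β‖` by `‖β - b‖`.
  refine ⟨κ / (4 * N), by positivity, 2 * (σ * (1 / κ + 1 / 2)) * (1 + ‖b‖ ^ 2), by positivity,
    fun a ha β => ?_⟩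
  obtain ⟨X, hX0, hX, hXe⟩ := lintegral_norm_step_sub_sq hN G P hgm (fun i x => (hσ i x).1) hbc a β
  set γ := copyNode n₀ β with hγ
  set c := a / N with hc
  have hc0 : 0 ≤ c := by positivity
  have hca : c ≤ a := div_le_self ha hN1
  have hgap : 0 ≤ objective P l γ - objective P l b :=
    sub_nonneg.2 (hb.2 _ (copyNode_mem_feasibleSet G n₀ β))
  rw [hX, ← ENNReal.ofReal_add hX0 (by positivity)]
  refine ENNReal.ofReal_le_ofReal ?_
  rw [hXe]
  set s : Fin N → LocalVar d := fun i => ∫ v, g i (β i) v ∂(P i) with hs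
  set s' : Fin N → LocalVar d := fun i => ∫ v, g i (γ i) v ∂(P i) with hs'
  -- Two subgradient inequalities are chained: at `β i` tested against `b i`, then at `γ i` tested
  -- against `β i`. The second replaces the loss at `β i` by the loss at `γ i`.
  have hnode : ∀ i, -(c * inner ℝ (s i) (β i - b i)) ≤
      -(c * (expectedLoss (P i) (l i) (γ i) - expectedLoss (P i) (l i) (b i))) +
      κ / 4 * ‖(β - γ) i‖ ^ 2 + c ^ 2 / κ * (σ * (1 + ‖γ i‖ ^ 2)) := by
    intro i
    have h1 : expectedLoss (P i) (l i) (β i) + inner ℝ (s i) (b i - β i) ≤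
      expectedLoss (P i) (l i) (b i) := hsub i (β i) (b i)
    have h2 : expectedLoss (P i) (l i) (γ i) + inner ℝ (s' i) (β i - γ i) ≤
      expectedLoss (P i) (l i) (β i) := hsub i (γ i) (β i)
    have h3 : ‖s' i‖ ^ 2 ≤ σ * (1 + ‖γ i‖ ^ 2) :=
      (norm_integral_sq_le (hgi i _) (hσ i _).1).trans (hσ i _).2
    have h4 : -inner ℝ (s' i) (β i - γ i) ≤ ‖s' i‖ * ‖β i - γ i‖ :=
      (neg_le_abs _).trans (abs_real_inner_le_norm _ _)
    -- Young's inequality, weighted by `κ` so that the consensus descent absorbs the quadratic term.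
    have h5 : c * (‖s' i‖ * ‖β i - γ i‖) ≤
        κ / 4 * ‖β i - γ i‖ ^ 2 + c ^ 2 / κ * ‖s' i‖ ^ 2 := by
      have : κ / 4 * ‖β i - γ i‖ ^ 2 + c ^ 2 / κ * ‖s' i‖ ^ 2 - c * (‖s' i‖ * ‖β i - γ i‖) =
          κ * (‖β i - γ i‖ / 2 - c / κ * ‖s' i‖) ^ 2 := by
        field_simp
        ring
      have h6 : 0 ≤ κ * (‖β i - γ i‖ / 2 - c / κ * ‖s' i‖) ^ 2 := by positivity
      linarith
    have h7 : c ^ 2 / κ * ‖s' i‖ ^ 2 ≤ c ^ 2 / κ * (σ * (1 + ‖γ i‖ ^ 2)) := by gcongr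
    have h8 : inner ℝ (s i) (b i - β i) = -inner ℝ (s i) (β i - b i) := by
      rw [← inner_neg_right, neg_sub]
    rw [h8] at h1
    have h9 : (β - γ) i = β i - γ i := rfl
    rw [h9]
    have h10 := mul_le_mul_of_nonneg_left h1 hc0
    have h11 := mul_le_mul_of_nonneg_left h2 hc0
    have h12 := mul_le_mul_of_nonneg_left h4 hc0
    rw [mul_add] at h10 h11
    linarith
  have hsum : -(c * ((1 / N) * ∑ i, inner ℝ (s i) (β i - b i))) ≤
      -(c * (objective P l γ - objective P l b)) + κ / (4 * N) * ‖β - γ‖ ^ 2 +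
      c ^ 2 / κ * ((1 / N) * ∑ i, σ * (1 + ‖γ i‖ ^ 2)) := by
    have h1 := mul_le_mul_of_nonneg_left
      (Finset.sum_le_sum fun i (_ : i ∈ Finset.univ) => hnode i) (one_div_nonneg.2 hNr.le)
    rw [Finset.sum_neg_distrib, Finset.sum_add_distrib, Finset.sum_add_distrib,
      Finset.sum_neg_distrib, ← Finset.mul_sum, ← Finset.mul_sum, ← Finset.mul_sum,
      ← Finset.mul_sum, Finset.sum_sub_distrib, ← PiLp.norm_sq_eq_of_L2] at h1
    have e1 : objective P l γ = (1 / N) * ∑ i, expectedLoss (P i) (l i) (γ i) := rfl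
    have e2 : objective P l b = (1 / N) * ∑ i, expectedLoss (P i) (l i) (b i) := rfl
    have e3 : κ / (4 * N) * ‖β - γ‖ ^ 2 = (1 / N) * (κ / 4 * ‖β - γ‖ ^ 2) := by field_simp
    rw [e1, e2, e3]
    linarith
  have hD := hreg β
  rw [← hγ] at hD
  have hD' : 1 / 2 * (1 / N * ∑ m, ‖β - averagingStep G m β‖ ^ 2) ≥
      2 * (κ / (4 * N) * ‖β - γ‖ ^ 2) := by
    have e : 2 * (κ / (4 * N) * ‖β - γ‖ ^ 2) = 1 / 2 * (1 / N * (κ * ‖β - γ‖ ^ 2)) := by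
      field_simp; ring
    rw [e]
    gcongr
  have hq : (1 / N) * ∑ i, ∫ v, ‖g i (β i) v‖ ^ 2 ∂(P i) ≤ σ * (1 + ‖β‖ ^ 2) :=
    (mul_le_mul_of_nonneg_left (Finset.sum_le_sum fun i _ => (hσ i (β i)).2)
      (one_div_nonneg.2 hNr.le)).trans (mean_growth_le hN hσ0 β)
  have hγn : (1 / N) * ∑ i, σ * (1 + ‖γ i‖ ^ 2) ≤ σ * (1 + ‖β‖ ^ 2) := by
    have h1 : ∀ i, γ i = β n₀ := fun _ => rfl
    simp only [h1, Finset.sum_const, Finset.card_univ, Fintype.card_fin, nsmul_eq_mul]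
    rw [one_div, inv_mul_cancel_left₀ hNr.ne']
    have := PiLp.norm_apply_le β n₀
    gcongr
  have hβ : 1 + ‖β‖ ^ 2 ≤ 2 * (1 + ‖b‖ ^ 2) * (1 + ‖β - b‖ ^ 2) := by
    have h1 : ‖β‖ ≤ ‖β - b‖ + ‖b‖ := by simpa using norm_add_le (β - b) b
    have h2 : ‖β‖ ^ 2 ≤ (‖β - b‖ + ‖b‖) ^ 2 := by gcongr
    nlinarith [sq_nonneg (‖β - b‖ - ‖b‖), mul_nonneg (sq_nonneg ‖β - b‖) (sq_nonneg ‖b‖)]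
  have h1 : c ^ 2 / κ * ((1 / N) * ∑ i, σ * (1 + ‖γ i‖ ^ 2)) ≤ c ^ 2 / κ * (σ * (1 + ‖β‖ ^ 2)) := by
    gcongr
  have h2 : c ^ 2 / 2 * ((1 / N) * ∑ i, ∫ v, ‖g i (β i) v‖ ^ 2 ∂(P i)) ≤
      c ^ 2 / 2 * (σ * (1 + ‖β‖ ^ 2)) := by gcongr
  have h3 : c ^ 2 / κ * (σ * (1 + ‖β‖ ^ 2)) + c ^ 2 / 2 * (σ * (1 + ‖β‖ ^ 2)) =
      c ^ 2 * (σ * (1 / κ + 1 / 2)) * (1 + ‖β‖ ^ 2) := by ring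
  have h4 : c ^ 2 * (σ * (1 / κ + 1 / 2)) * (1 + ‖β‖ ^ 2) ≤
      a ^ 2 * (σ * (1 / κ + 1 / 2)) * (2 * (1 + ‖b‖ ^ 2) * (1 + ‖β - b‖ ^ 2)) := by gcongr
  linarith

/-! ### From quasi-Fejér monotonicity to convergence -/

/-- Deterministic conclusion: quasi-Fejér monotonicity relative to a dense set of optimal points,
and summability of the weighted optimality gap, force convergence to the optimal set. -/
lemma tendsto_DF_DO {N d : ℕ} {G : SimpleGraph (Fin N)} {S : Type*} [MeasurableSpace S]
    {P : Fin N → Measure S} {l : Fin N → LocalVar d → S → ℝ} (hF : Continuous (objective P l))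
    (n₀ : Fin N) {α : ℕ → ℝ} (hα : ∀ k, 0 ≤ α k) (hα_sum : ¬ Summable α) {x : ℕ → NetVar N d}
    {b : ℕ → optimalSet G P l} (hb : DenseRange b)
    (hconv : ∀ n, ∃ L, Tendsto (fun k => ‖x k - b n‖ ^ 2) atTop (𝓝 L)) {κ : ℝ} (hκ : 0 < κ)
    (hsum : Summable fun k => κ * ‖x k - copyNode n₀ (x k)‖ ^ 2 +
      α k / N * (objective P l (copyNode n₀ (x k)) - objective P l (b 0))) :
    Tendsto (fun k => DF G (x k)) atTop (𝓝 0) ∧ Tendsto (fun k => DO G P l (x k)) atTop (𝓝 0) := by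
  have hNr : (0 : ℝ) < N := Nat.cast_pos.2 n₀.pos
  have hfeas : ∀ k, copyNode n₀ (x k) ∈ feasibleSet d G := fun k =>
    copyNode_mem_feasibleSet G n₀ _
  have hgap : ∀ k, 0 ≤ objective P l (copyNode n₀ (x k)) - objective P l (b 0) := fun k =>
    sub_nonneg.2 ((b 0).2.2 _ (hfeas k))
  have hgap' : ∀ k, 0 ≤ α k / N * (objective P l (copyNode n₀ (x k)) - objective P l (b 0)) :=
    fun k => mul_nonneg (div_nonneg (hα k) hNr.le) (hgap k)
  have hcons0 : ∀ k, 0 ≤ κ * ‖x k - copyNode n₀ (x k)‖ ^ 2 := fun k => by positivity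
  have hcons : Tendsto (fun k => ‖x k - copyNode n₀ (x k)‖) atTop (𝓝 0) := by
    have h1 : Summable fun k => κ * ‖x k - copyNode n₀ (x k)‖ ^ 2 :=
      Summable.of_nonneg_of_le hcons0 (fun k => by linarith [hgap' k]) hsum
    have h2 := ((summable_mul_left_iff hκ.ne').1 h1).tendsto_atTop_zero.sqrt
    simpa [Real.sqrt_sq] using h2
  refine ⟨squeeze_zero (fun k => Metric.infDist_nonneg) (fun k => ?_) hcons, ?_⟩
  · rw [← dist_eq_norm]
    exact Metric.infDist_le_dist_of_mem (hfeas k)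
  have hgs : Summable fun k =>
      α k / N * (objective P l (copyNode n₀ (x k)) - objective P l (b 0)) :=
    Summable.of_nonneg_of_le hgap' (fun k => by linarith [hcons0 k]) hsum
  -- A gap eventually bounded below would make `α` summable by comparison with the weighted gaps.
  have hfreq : ∀ n : ℕ, ∃ᶠ k in atTop,
      objective P l (copyNode n₀ (x k)) - objective P l (b 0) < 1 / ((n : ℝ) + 1) := by
    intro n hev
    refine hα_sum ?_
    refine Summable.of_norm_bounded_eventually_nat (hgs.mul_left (N * ((n : ℝ) + 1))) ?_
    filter_upwards [hev] with k hk
    rw [not_lt, div_le_iff₀ (by positivity)] at hk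
    rw [Real.norm_of_nonneg (hα k)]
    have h1 := mul_le_mul_of_nonneg_left hk (hα k)
    calc α k = α k * 1 := (mul_one _).symm
      _ ≤ _ := h1
      _ = _ := by field_simp
  obtain ⟨φ, hφ, hφgap⟩ := extraction_forall_of_frequently hfreq
  obtain ⟨L₀, hL₀⟩ := hconv 0
  obtain ⟨M, hM⟩ := hL₀.bddAbove_range
  have hball : ∀ k, x (φ k) ∈ Metric.closedBall (b 0 : NetVar N d) (Real.sqrt M) := fun k => by
    rw [Metric.mem_closedBall, dist_eq_norm]
    exact Real.le_sqrt_of_sq_le (hM ⟨φ k, rfl⟩)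
  obtain ⟨y, -, ψ, hψ, hy⟩ := (isCompact_closedBall _ _).tendsto_subseq hball
  have hsub : Tendsto (fun k => φ (ψ k)) atTop atTop := hφ.tendsto_atTop.comp hψ.tendsto_atTop
  -- The copied points are feasible and share the limit `y`, because the consensus error vanishes.
  have hy' : Tendsto (fun k => copyNode n₀ (x (φ (ψ k)))) atTop (𝓝 y) := by
    have h1 := hy.sub (tendsto_zero_iff_norm_tendsto_zero.2 (hcons.comp hsub))
    simpa using h1
  have hyopt : y ∈ optimalSet G P l := by
    refine ⟨(isClosed_feasibleSet G).mem_of_tendsto hy' (Eventually.of_forall fun k => hfeas _),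
      fun γ hγ => le_trans ?_ ((b 0).2.2 γ hγ)⟩
    have h1 : Tendsto (fun k => objective P l (copyNode n₀ (x (φ (ψ k)))) - objective P l (b 0))
        atTop (𝓝 (objective P l y - objective P l (b 0))) :=
      ((hF.tendsto y).comp hy').sub_const _
    have h2 := le_of_tendsto_of_tendsto' h1
      (tendsto_one_div_add_atTop_nhds_zero_nat.comp hψ.tendsto_atTop) fun k => (hφgap (ψ k)).le
    linarith
  refine Metric.tendsto_atTop.2 fun ε hε => ?_
  -- The distance to `b n` converges along the whole sequence, and the subsequence identifies its
  -- limit as `‖y - b n‖ < ε`.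
  obtain ⟨n, hn⟩ := hb.exists_dist_lt ⟨y, hyopt⟩ hε
  obtain ⟨L, hL⟩ := hconv n
  have hLy : L = ‖y - b n‖ ^ 2 :=
    tendsto_nhds_unique (hL.comp hsub) ((hy.sub_const _).norm.pow 2)
  have hLε : L < ε ^ 2 := by
    rw [Subtype.dist_eq, dist_eq_norm] at hn
    rw [hLy]
    gcongr
  obtain ⟨K, hK⟩ := eventually_atTop.1 (hL.eventually_lt_const hLε)
  refine ⟨K, fun k hk => ?_⟩
  rw [Real.dist_0_eq_abs, DO, abs_of_nonneg Metric.infDist_nonneg]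
  refine (Metric.infDist_le_dist_of_mem (b n).2).trans_lt ?_
  rw [dist_eq_norm]
  exact lt_of_pow_lt_pow_left₀ 2 hε.le (hK k hk)

end AsyncSGD

/-! ### Almost sure convergence -/

theorem mainTheorem2
    {N d : ℕ} (G : SimpleGraph (Fin N)) [DecidableRel G.Adj] (hG : G.Connected)
    {S : Type*} [MeasurableSpace S]
    -- data laws, losses and subgradient oracles of the nodes
    (P : Fin N → Measure S) [∀ i, IsProbabilityMeasure (P i)]
    (l : Fin N → AsyncSGD.LocalVar d → S → ℝ)
    (g : Fin N → AsyncSGD.LocalVar d → S → AsyncSGD.LocalVar d)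
    (hl : ∀ i x, Integrable (l i x) (P i))
    (hconv : ∀ i, ConvexOn ℝ Set.univ (AsyncSGD.expectedLoss (P i) (l i)))
    (hgmeas : ∀ i, Measurable (Function.uncurry (g i)))
    (hg : ∀ i, AsyncSGD.IsSubgradientOracle (P i) (l i) (g i))
    (σ : ℝ)
    (hσ : ∀ i x, Integrable (fun v => ‖g i x v‖ ^ 2) (P i) ∧
      ∫ v, ‖g i x v‖ ^ 2 ∂(P i) ≤ σ * (1 + ‖x‖ ^ 2))
    (hopt : (AsyncSGD.optimalSet G P l).Nonempty)
    -- stepsizes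
    (α : ℕ → ℝ) (hα : ∀ k, 0 ≤ α k) (hα_sum : ¬ Summable α)
    (hα_sq : Summable fun k => α k ^ 2)
    -- the algorithm, driven by independent draws
    (β₀ : AsyncSGD.NetVar N d)
    {Ω : Type*} [MeasurableSpace Ω] (μ : Measure Ω) [IsProbabilityMeasure μ]
    (ξ : ℕ → Ω → Fin N × ℝ × S) (hξ_meas : ∀ k, Measurable (ξ k))
    (hξ_law : ∀ k, μ.map (ξ k) = AsyncSGD.drawLaw P)
    (hξ_indep : iIndepFun ξ μ) :
    ∀ᵐ ω ∂μ,
      Tendsto (fun k => AsyncSGD.DF G (AsyncSGD.iterates G g α β₀ (fun t => ξ t ω) k))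
        atTop (𝓝 0) ∧
      Tendsto (fun k => AsyncSGD.DO G P l (AsyncSGD.iterates G g α β₀ (fun t => ξ t ω) k))
        atTop (𝓝 0) := by
  open AsyncSGD in
  obtain ⟨n₀⟩ := hG.nonempty
  have : Nonempty (optimalSet G P l) := hopt.to_subtype
  -- The null set in Robbins–Siegmund depends on the reference point; a countable dense family keeps
  -- the union null.
  set b := TopologicalSpace.denseSeq (optimalSet G P l)
  set x : ℕ → Ω → NetVar N d := fun k ω => iterates G g α β₀ (fun t => ξ t ω) k
  choose κ hκ C hC hdrift using fun n =>
    exists_drift hG n₀ hl hgmeas hg hσ (b n).2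
  have hobj := continuous_objective hconv
  have hcopy : Continuous fun β : NetVar N d => copyNode n₀ β :=
    (PiLp.continuous_toLp 2 _).comp (continuous_pi fun _ => PiLp.continuous_apply 2 _ n₀)
  have hae : ∀ᵐ ω ∂μ, ∀ n, (∃ L, Tendsto (fun k => ‖x k ω - b n‖ ^ 2) atTop (𝓝 L)) ∧
      Summable fun k => κ n * ‖x k ω - copyNode n₀ (x k ω)‖ ^ 2 +
        α k / N * (objective P l (copyNode n₀ (x k ω)) - objective P l (b n)) := by
    refine ae_all_iff.2 fun n => ?_
    refine robbinsSiegmund_of_recursion hξ_meas hξ_law hξ_indep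
      (T := fun k => step G g (α k)) (fun k => measurable_step G hgmeas (α k))
      (x := x) (x₀ := β₀) (fun _ => rfl) (fun _ _ => rfl)
      (V := fun β => ‖β - b n‖ ^ 2)
      (U := fun k β => κ n * ‖β - copyNode n₀ β‖ ^ 2 +
        α k / N * (objective P l (copyNode n₀ β) - objective P l (b n)))
      (a := fun k => C n * α k ^ 2) (b := fun k => C n * α k ^ 2)
      ?_ (fun k => ?_) (fun β => by positivity) (fun k β => ?_)
      (fun k => mul_nonneg (hC n) (sq_nonneg _)) (fun k => mul_nonneg (hC n) (sq_nonneg _))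
      (hα_sq.mul_left _) (hα_sq.mul_left _) (fun k β => hdrift n (α k) (hα k) β)
    · exact ((continuous_id.sub continuous_const).norm.pow 2).measurable
    · exact ((continuous_const.mul ((continuous_id.sub hcopy).norm.pow 2)).add
        (continuous_const.mul ((hobj.comp hcopy).sub continuous_const))).measurable
    · exact add_nonneg (mul_nonneg (hκ n).le (sq_nonneg _))
        (mul_nonneg (div_nonneg (hα k) (Nat.cast_nonneg N))
          (sub_nonneg.2 ((b n).2.2 _ (copyNode_mem_feasibleSet G n₀ β))))
  filter_upwards [hae] with ω hω
  exact tendsto_DF_DO hobj n₀ hα hα_sum (TopologicalSpace.denseRange_denseSeq _)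
    (fun n => (hω n).1) (hκ 0) (hω 0).2
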